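/- Let $r>1$, let $m_1\ge m_2\ge\cdots\ge m_r$ be integers, and let $E=\mathcal{O}(m_1)\oplus\cdots\oplus\mathcal{O}(m_r)$ be the corresponding holomorphic vector bundle on the complex projective line $\mathbb{P}^1$. A co-Higgs field on $E$ is an element $\varphi\in H^0(\mathbb{P}^1;\operatorname{End}E\otimes\mathcal{O}(2))$. A holomorphic subbundle $U\subset E$ is $\varphi$-invariant if $\varphi(U)\subseteq U\otimes\mathcal{O}(2)$, and $\varphi$ is called semistable (respectively stable) if $$\frac{\deg U}{\operatorname{rk}U}\le\frac{\deg E}{\operatorname{rk}E}\qquad\Bigl(\text{respectively } \frac{\deg U}{\operatorname{rk}U}<\frac{\deg E}{\operatorname{rk}E}\Bigr)$$ for every $\varphi$-invariant subbundle $U$ of $E$ with $0<\operatorname{rk}U<r$. Then $E$ admits a semistable co-Higgs field if and only if $m_i\le m_{i+1}+2$ for all $1\le i\le r-1$. Moreover, if this condition holds, then there is a nonempty Zariski open subset of the finite-dimensional complex vector space $H^0(\mathbb{P}^1;\operatorname{End}E\otimes\mathcal{O}(2))$ such that every $\varphi$ in it leaves invariant no holomorphic subbundle $U$ of $E$ with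 $0<\operatorname{rk}U<r$; in particular, every such $\varphi$ is stable. -/

import Mathlib

/-!
Holomorphic vector bundles on `ℙ¹ = ℂ ∪ {∞}`, with the two standard charts `z` (on `ℙ¹ ∖ {∞}`) and
`w = 1 / z` (on `ℙ¹ ∖ {0}`). In all definitions the suffix `0` refers to the chart `z`, the suffix
`1` to the chart `w`.
-/

open scoped Matrix

noncomputable section

namespace CoHiggs

/-- A holomorphic vector bundle of rank `n` on `ℙ¹`, given by its transition function
`g : ℂ ∖ {0} → GL_n(ℂ)`: it is glued from the two copies `ℂ × ℂⁿ` over the charts `z` and `w` by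
`(z, v) ∼ (w, g z *ᵥ v)`, `w = z⁻¹`, for `z ≠ 0`. (Holomorphic bundles on `ℂ` are trivial, so every
holomorphic bundle on `ℙ¹` is of this form. The value of `g` at `0` is irrelevant.) -/
structure HolBundle (n : ℕ) where
  g : ℂ → Matrix (Fin n) (Fin n) ℂ
  holo : ∀ i j, DifferentiableOn ℂ (fun z => g z i j) {0}ᶜ
  det_ne_zero : ∀ z, z ≠ 0 → (g z).det ≠ 0

/-- The bundle `𝒪(m₁) ⊕ ⋯ ⊕ 𝒪(mᵣ)`. Here `𝒪(m)` has the transition function `z ^ (-m)`, that is,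
a section of `𝒪(m)` is a pair of functions with `s₀(z) = z ^ m * s₁(1 / z)`. -/
def splitBundle {r : ℕ} (m : Fin r → ℤ) : HolBundle r where
  g z := Matrix.diagonal fun i => z ^ (-m i)
  holo i j := by
    by_cases h : i = j
    · subst h
      simp only [Matrix.diagonal_apply_eq]
      intro z hz
      exact (differentiableAt_zpow.2 (Or.inl hz)).differentiableWithinAt
    · simp only [Matrix.diagonal_apply_ne _ h]
      exact differentiableOn_const _
  det_ne_zero z hz := by
    rw [Matrix.det_diagonal]
    exact Finset.prod_ne_zero_iff.2 fun i _ => zpow_ne_zero _ hz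

/-- The tensor product `E ⊗ 𝒪(d)`. -/
def HolBundle.twist {n : ℕ} (E : HolBundle n) (d : ℤ) : HolBundle n where
  g z := z ^ (-d) • E.g z
  holo i j := by
    intro z hz
    exact (differentiableAt_zpow.2 (Or.inl hz)).differentiableWithinAt.mul (E.holo i j z hz)
  det_ne_zero z hz := by
    rw [Matrix.det_smul]
    exact mul_ne_zero (pow_ne_zero _ (zpow_ne_zero _ hz)) (E.det_ne_zero z hz)

/-- The degree (first Chern number) of a bundle: minus the winding number of `det g` along the unit
circle. The sign is such that `𝒪(m)` has degree `m`. -/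
def HolBundle.degree {n : ℕ} (E : HolBundle n) : ℝ :=
  -((2 * (Real.pi : ℂ) * Complex.I)⁻¹ *
    ∮ z in C(0, 1), logDeriv (fun u => (E.g u).det) z).re

/-- The complex vector space `H⁰(ℙ¹, Hom(V, E))` of holomorphic bundle maps `V → E`: pairs of
entire matrix-valued functions, one for each chart, compatible with the gluing. -/
def homs {k n : ℕ} (V : HolBundle k) (E : HolBundle n) :
    Submodule ℂ ((ℂ → Matrix (Fin n) (Fin k) ℂ) × (ℂ → Matrix (Fin n) (Fin k) ℂ)) where
  carrier := {f | (∀ i j, Differentiable ℂ fun z => f.1 z i j) ∧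
    (∀ i j, Differentiable ℂ fun w => f.2 w i j) ∧
    ∀ z, z ≠ 0 → f.2 z⁻¹ * V.g z = E.g z * f.1 z}
  zero_mem' := ⟨fun _ _ => differentiable_const _, fun _ _ => differentiable_const _, by simp⟩
  add_mem' := by
    rintro a b ⟨ha0, ha1, ha⟩ ⟨hb0, hb1, hb⟩
    refine ⟨fun i j => (ha0 i j).add (hb0 i j), fun i j => (ha1 i j).add (hb1 i j), ?_⟩
    intro z hz
    simp only [Prod.fst_add, Prod.snd_add, Pi.add_apply, Matrix.add_mul, Matrix.mul_add,
      ha z hz, hb z hz]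
  smul_mem' := by
    rintro c a ⟨ha0, ha1, ha⟩
    refine ⟨fun i j => (ha0 i j).const_mul c, fun i j => (ha1 i j).const_mul c, ?_⟩
    intro z hz
    simp only [Prod.smul_fst, Prod.smul_snd, Pi.smul_apply, Matrix.smul_mul, Matrix.mul_smul,
      ha z hz]

/-- The space `H⁰(ℙ¹, End E ⊗ 𝒪(2)) = H⁰(ℙ¹, Hom(E, E ⊗ 𝒪(2)))` of co-Higgs fields on `E`
(`𝒪(2)` is the tangent bundle of `ℙ¹`). -/
abbrev HiggsField {n : ℕ} (E : HolBundle n) : Type := homs E (E.twist 2)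

/-- `fib` is a holomorphic family, parametrized by `ℂ`, of `k`-dimensional subspaces of `ℂⁿ`: near
every point it has a holomorphic frame. -/
def IsHolFamily {n : ℕ} (k : ℕ) (fib : ℂ → Submodule ℂ (Fin n → ℂ)) : Prop :=
  ∀ z₀ : ℂ, ∃ F : ℂ → Matrix (Fin n) (Fin k) ℂ,
    (∀ i j, AnalyticAt ℂ (fun z => F z i j) z₀) ∧
    ∀ᶠ z in nhds z₀, LinearIndependent ℂ (F z).col ∧ Submodule.span ℂ (Set.range (F z).col) = fib z

/-- A holomorphic subbundle of rank `k` of `E`. -/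
structure Subbundle {n : ℕ} (E : HolBundle n) (k : ℕ) where
  fib0 : ℂ → Submodule ℂ (Fin n → ℂ)
  fib1 : ℂ → Submodule ℂ (Fin n → ℂ)
  holo0 : IsHolFamily k fib0
  holo1 : IsHolFamily k fib1
  glue : ∀ z, z ≠ 0 → (fib0 z).map (Matrix.toLin' (E.g z)) = fib1 z⁻¹

/-- `U` is `φ`-invariant: `φ(U) ⊆ U ⊗ 𝒪(2)`. -/
def Subbundle.IsInvariant {n k : ℕ} {E : HolBundle n} (U : Subbundle E k) (φ : HiggsField E) :
    Prop :=
  (∀ z, ∀ v ∈ U.fib0 z, φ.1.1 z *ᵥ v ∈ U.fib0 z) ∧ ∀ w, ∀ v ∈ U.fib1 w, φ.1.2 w *ᵥ v ∈ U.fib1 w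

/-- The subbundle `U` has degree `d`: it is the isomorphic image, under a holomorphic bundle map,
of a bundle `V` of degree `d`. (Such a `V` always exists, and all choices have the same degree.) -/
def Subbundle.HasDegree {n k : ℕ} {E : HolBundle n} (U : Subbundle E k) (d : ℝ) : Prop :=
  ∃ V : HolBundle k, ∃ ι : homs V E,
    (∀ z, LinearMap.range (Matrix.toLin' (ι.1.1 z)) = U.fib0 z) ∧
    (∀ w, LinearMap.range (Matrix.toLin' (ι.1.2 w)) = U.fib1 w) ∧ V.degree = d

/-- `(E, φ)` is semistable: `deg U / rk U ≤ deg E / rk E` for each proper nonzero `φ`-invariant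
subbundle `U` of `E`. -/
def IsSemistable {n : ℕ} {E : HolBundle n} (φ : HiggsField E) : Prop :=
  ∀ k : ℕ, 0 < k → k < n → ∀ U : Subbundle E k, U.IsInvariant φ →
    ∀ d : ℝ, U.HasDegree d → d / k ≤ E.degree / n

/-- `(E, φ)` is stable: `deg U / rk U < deg E / rk E` for each proper nonzero `φ`-invariant
subbundle `U` of `E`. -/
def IsStable {n : ℕ} {E : HolBundle n} (φ : HiggsField E) : Prop :=
  ∀ k : ℕ, 0 < k → k < n → ∀ U : Subbundle E k, U.IsInvariant φ →
    ∀ d : ℝ, U.HasDegree d → d / k < E.degree / n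

/-- The polynomial functions on a complex vector space: the algebra of functions generated by the
linear forms. -/
def polyFunctions (W : Type*) [AddCommGroup W] [Module ℂ W] : Subalgebra ℂ (W → ℂ) :=
  Algebra.adjoin ℂ (Set.range fun l : Module.Dual ℂ W => (l : W → ℂ))

/-- Zariski open subsets of a complex vector space: complements of common zero sets of polynomial
functions. -/
def IsZariskiOpen {W : Type*} [AddCommGroup W] [Module ℂ W] (S : Set W) : Prop :=
  ∃ A : Set (W → ℂ), A ⊆ polyFunctions W ∧ Sᶜ = {v | ∀ f ∈ A, f v = 0}

end CoHiggs

end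

/-! Necessity: the entry of `φ` from the `j`-th to the `i`-th summand is a section of `𝒪(mᵢ - mⱼ +
2)`. If some consecutive gap exceeds `2`, all entries from the summands before the gap to those
after it vanish, so the summands before it form an invariant subbundle, whose slope is too large.

Sufficiency passes from subbundles to spectral data. If `U` of rank `k` is invariant, the
characteristic polynomial of `φ` on `U` is a monic factor of degree `k` of that of `φ`; its
coefficients are sections of `𝒪(2(k - i))`, hence polynomials in `z` of degree at most `2k`,
whatever the degree of `U` (`exists_factor_of_isInvariant`). It remains to show that having such a
factor is a closed condition and that it fails somewhere.

Closedness (`exists_separating_function`): on the set `T` of fields with a factor, all the factors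
together form one factor over the ring `ℂ^T`. Its coefficients are integral over the polynomial
functions, so by lying over it specializes to every point at which all functions vanishing on `T`
vanish, at the cost of replacing `ℂ` by a larger domain.

Failure: the gap condition makes the companion matrix of `Y ^ r - z` a co-Higgs field, and
Eisenstein's criterion makes its characteristic polynomial irreducible over every domain. Stability
then holds vacuously on a nonempty open set. -/

namespace CoHiggs

-- Monic factors of bivariate polynomials: integrality and specialization

universe u

open Polynomial

/-- The base change of bivariate polynomials along a ring homomorphism. -/
noncomputable abbrev bimap {A B : Type*} [CommRing A] [CommRing B] (f : A →+* B) : A[X][X] →+* B[X][X] :=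
  mapRingHom (mapRingHom f)

theorem bimap_comp {A B C : Type*} [CommRing A] [CommRing B] [CommRing C] (f : A →+* B)
    (g : B →+* C) (P : A[X][X]) : bimap g (bimap f P) = bimap (g.comp f) P := by
  simp [bimap, Polynomial.map_map]

theorem bimap_injective {A B : Type*} [CommRing A] [CommRing B] (f : A →+* B)
    (hf : Function.Injective f) : Function.Injective (bimap f) :=
  map_injective _ (map_injective _ hf)

theorem bimap_modByMonic {A B : Type*} [CommRing A] [CommRing B] (f : A →+* B) {P Q : A[X][X]}
    (hQ : Q.Monic) : bimap f (P %ₘ Q) = bimap f P %ₘ bimap f Q :=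
  map_modByMonic _ hQ

/-- The coefficients of a monic factor of a monic bivariate polynomial are integral. -/
theorem isIntegral_coeff_coeff_of_dvd {R B : Type*} [CommRing R] [CommRing B] [Algebra R B]
    {P : R[X][X]} (hP : P.Monic) {Q : B[X][X]} (hQ : Q.Monic)
    (hdvd : Q ∣ bimap (algebraMap R B) P) (i j : ℕ) : IsIntegral R ((Q.coeff i).coeff j) := by
  let _ : Algebra R[X] B[X] := Polynomial.algebra R B
  -- Integrality is used twice: over `R[X]` for the coefficients of the factor, then over `R` for
  -- the coefficients of a polynomial integral over `R[X]`.
  have h1 : IsIntegral R[X] (Q.coeff i) := isIntegral_coeff_of_dvd P Q hP hQ hdvd i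
  exact (Polynomial.isIntegral_iff_isIntegral_coeff.1 h1) j

/-- A bivariate polynomial whose coefficients are in the range of `f` lifts along `f`. -/
theorem exists_monic_bimap_eq {A B : Type*} [CommRing A] [CommRing B] [Nontrivial A]
    (f : A →+* B)
    (hf : Function.Injective f) {Q : B[X][X]} (hQ : Q.Monic)
    (h : ∀ i j, (Q.coeff i).coeff j ∈ Set.range f) :
    ∃ Q' : A[X][X], Q'.Monic ∧ Q'.natDegree = Q.natDegree ∧ bimap f Q' = Q := by
  have h1 : Q ∈ lifts (mapRingHom f) := by
    rw [lifts_iff_coeff_lifts]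
    intro i
    have : Q.coeff i ∈ lifts f := by
      rw [lifts_iff_coeff_lifts]
      exact h i
    obtain ⟨q, hq⟩ := (mem_lifts _).1 this
    exact ⟨q, hq⟩
  obtain ⟨Q', hQ'⟩ := (mem_lifts _).1 h1
  have hinj : Function.Injective (mapRingHom f) := map_injective _ hf
  refine ⟨Q', ?_, ?_, hQ'⟩
  · exact Polynomial.monic_of_injective hinj (by rw [hQ']; exact hQ)
  · rw [← hQ', natDegree_map_eq_of_injective hinj]

/-- Monic factors specialize: if the base change of `P` to `B` has a monic factor of degree `k`,
then so has the base change to a domain over the residue ring at any prime containing the kernel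
of `R → B`. -/
theorem exists_monic_factor_specialization {R : Type*} {B : Type u} [CommRing R] [CommRing B] (ρ : R →+* B)
    {P : R[X][X]} (hP : P.Monic) {Q : B[X][X]} (hQ : Q.Monic) (hdvd : Q ∣ bimap ρ P)
    (p : Ideal R) [p.IsPrime] (hp : RingHom.ker ρ ≤ p) :
    ∃ (D : Type u) (_ : CommRing D) (_ : IsDomain D) (σ : R →+* D) (Q' : D[X][X]),
      p ≤ RingHom.ker σ ∧ Q'.Monic ∧ Q'.natDegree = Q.natDegree ∧ Q' ∣ bimap σ P := by
  let _ : Algebra R B := ρ.toAlgebra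
  let A := integralClosure R B
  have hker : RingHom.ker (algebraMap R A) ≤ p := by
    intro x hx
    apply hp
    rw [RingHom.mem_ker] at hx ⊢
    exact congrArg Subtype.val hx
  -- Lying over for `R → A`. The ring `B` need not be a domain; the quotient of `A` by the prime `q`
  -- is one.
  obtain ⟨q, -, hq, hqp⟩ := Ideal.exists_ideal_over_prime_of_isIntegral (S := A) p ⊥ (by
    simpa [RingHom.ker_eq_comap_bot] using hker)
  have : Nontrivial A := by
    refine ⟨0, 1, fun h => hq.ne_top ((Ideal.eq_top_iff_one _).2 (h ▸ q.zero_mem))⟩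
  have hA : Function.Injective (algebraMap A B) := Subtype.val_injective
  obtain ⟨Q₁, hQ₁, hdeg, hmap⟩ := exists_monic_bimap_eq (algebraMap A B) hA hQ (by
    intro i j
    exact ⟨⟨_, isIntegral_coeff_coeff_of_dvd hP hQ hdvd i j⟩, rfl⟩)
  -- Division by a monic polynomial commutes with base change, so the remainder over `A` vanishes
  -- because its image over `B` does.
  have hdvd₁ : Q₁ ∣ bimap (algebraMap R A) P := by
    rw [← modByMonic_eq_zero_iff_dvd hQ₁]
    apply bimap_injective _ hA
    rw [bimap_modByMonic _ hQ₁, hmap, bimap_comp, ← IsScalarTower.algebraMap_eq, map_zero]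
    exact (modByMonic_eq_zero_iff_dvd hQ).2 hdvd
  refine ⟨A ⧸ q, inferInstance, inferInstance, (Ideal.Quotient.mk q).comp (algebraMap R A),
    bimap (Ideal.Quotient.mk q) Q₁, ?_, hQ₁.map _, ?_, ?_⟩
  · intro x hx
    rw [← hqp] at hx
    rw [RingHom.mem_ker, RingHom.comp_apply, Ideal.Quotient.eq_zero_iff_mem]
    exact hx
  · rw [← hdeg]
    exact hQ₁.natDegree_map _
  · rw [← bimap_comp]
    exact _root_.map_dvd _ hdvd₁

/-- Evaluation of the functions in an algebra at a point. -/
noncomputable def evalAt {W : Type*} (R : Subalgebra ℂ (W → ℂ)) (w : W) : R →ₐ[ℂ] ℂ :=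
  (Pi.evalAlgHom ℂ (fun _ : W => ℂ) w).comp R.val

/-- A family of monic bivariate polynomials of bounded degree is a polynomial over the ring of
functions on the parameter set. -/
theorem exists_monic_of_family {T F : Type*} [Field F] (q : T → F[X][X]) (k N : ℕ)
    (hm : ∀ t, (q t).Monic) (hd : ∀ t, (q t).natDegree = k)
    (hN : ∀ t i, ((q t).coeff i).natDegree ≤ N) :
    ∃ Q : (T → F)[X][X], Q.Monic ∧ ∀ t, bimap (Pi.evalRingHom (fun _ : T => F) t) Q = q t := by
  let Q : (T → F)[X][X] := ∑ i ∈ Finset.range (k + 1), monomial i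
    (∑ j ∈ Finset.range (N + 1), monomial j fun t => ((q t).coeff i).coeff j)
  have hcoeff : ∀ i j, (Q.coeff i).coeff j = fun t => ((q t).coeff i).coeff j := by
    intro i j
    simp only [Q, finsetSum_coeff, coeff_monomial, Finset.sum_ite_eq', Finset.mem_range]
    split_ifs with hi
    · simp only [finsetSum_coeff, coeff_monomial, Finset.sum_ite_eq', Finset.mem_range]
      split_ifs with hj
      · rfl
      · funext t
        exact (coeff_eq_zero_of_natDegree_lt ((hN t i).trans_lt (by omega))).symm
    · funext t
      rw [coeff_eq_zero_of_natDegree_lt (p := q t) (by rw [hd]; omega)]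
      simp
  refine ⟨Q, monic_of_natDegree_le_of_coeff_eq_one k ?_ ?_, ?_⟩
  · refine natDegree_sum_le_of_forall_le _ _ fun i hi => (natDegree_monomial_le _).trans ?_
    exact Nat.lt_succ_iff.1 (Finset.mem_range.1 hi)
  · ext j t
    have h1 : (q t).coeff k = 1 := hd t ▸ hm t
    rw [hcoeff, coeff_one]
    change ((q t).coeff k).coeff j = _
    rw [h1, coeff_one]
    split_ifs <;> rfl
  · intro t
    ext i j
    rw [coe_mapRingHom, coeff_map, coe_mapRingHom, coeff_map, hcoeff]
    rfl

/-- Having a monic factor of given degree and bounded coefficients is a closed condition: if `P`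
has no monic factor of degree `k` at `w₀`, even after extension of scalars, then some function in
`R` separates `w₀` from the points where there is such a factor. -/
theorem exists_separating_function {W : Type} (R : Subalgebra ℂ (W → ℂ)) {P : R[X][X]}
    (hP : P.Monic) (w₀ : W) (k N : ℕ)
    (h₀ : ∀ (D : Type) [CommRing D] [IsDomain D] (τ : ℂ →+* D) (Q : D[X][X]), Q.Monic →
      Q.natDegree = k → ¬ Q ∣ bimap (τ.comp (evalAt R w₀ : R →+* ℂ)) P) :
    ∃ f : R, f.1 w₀ ≠ 0 ∧ ∀ w, (∃ Q : ℂ[X][X], Q.Monic ∧ Q.natDegree = k ∧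
      (∀ i, (Q.coeff i).natDegree ≤ N) ∧ Q ∣ bimap (evalAt R w : R →+* ℂ) P) → f.1 w = 0 := by
  by_contra! hcon
  let T : Set W := {w | ∃ Q : ℂ[X][X], Q.Monic ∧ Q.natDegree = k ∧
      (∀ i, (Q.coeff i).natDegree ≤ N) ∧ Q ∣ bimap (evalAt R w : R →+* ℂ) P}
  choose q hqm hqd hqN hq using fun t : T => t.2
  let ev : T → (T → ℂ) →+* ℂ := fun t => Pi.evalRingHom _ t
  let ρ : R →+* (T → ℂ) := RingHom.pi fun t => (evalAt R t.1 : R →+* ℂ)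
  have hTne : Nonempty T := by
    obtain ⟨w, hw, -⟩ := hcon 1 (by simp)
    exact ⟨⟨w, hw⟩⟩
  -- The bound `N` enters here: without it the factors need not assemble into a polynomial over `T →
  -- ℂ`.
  obtain ⟨Q, hQm, hev⟩ := exists_monic_of_family q k N hqm hqd hqN
  have hQd : Q.natDegree = k := by
    obtain ⟨t⟩ := hTne
    rw [← hqd t, ← hev t]
    exact (hQm.natDegree_map _).symm
  have hdvd : Q ∣ bimap ρ P := by
    rw [← modByMonic_eq_zero_iff_dvd hQm]
    have key : ∀ t, bimap (ev t) (bimap ρ P %ₘ Q) = 0 := by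
      intro t
      rw [bimap_modByMonic _ hQm, hev, bimap_comp, modByMonic_eq_zero_iff_dvd (hqm t)]
      exact hq t
    ext i j t
    have := congrArg (fun p => (p.coeff i).coeff j) (key t)
    simpa [bimap, coeff_map, ev] using this
  have hprime : (RingHom.ker (evalAt R w₀ : R →+* ℂ)).IsPrime := RingHom.ker_isPrime _
  obtain ⟨D, _, _, σ, Q', hσ, hQ'm, hQ'd, hQ'⟩ := exists_monic_factor_specialization ρ hP hQm hdvd
    (RingHom.ker (evalAt R w₀ : R →+* ℂ)) (by
      -- If no function separates `w₀` from `T`, every function vanishing on `T` vanishes at `w₀`,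
      -- so the kernel of `ρ` lies in the ideal of `w₀`.
      intro f hf
      by_contra hne
      obtain ⟨w, hw, hfw⟩ := hcon f hne
      exact hfw (congrFun hf ⟨w, hw⟩))
  refine h₀ D (σ.comp (algebraMap ℂ R)) Q' hQ'm (hQ'd.trans hQd) ?_
  convert hQ' using 2
  congr 1
  ext f
  -- Since `σ` kills the ideal of `w₀`, it factors through evaluation at `w₀`.
  have : f - algebraMap ℂ R (evalAt R w₀ f) ∈ RingHom.ker σ := by
    apply hσ
    rw [RingHom.mem_ker]
    simp
  rw [RingHom.mem_ker, map_sub, sub_eq_zero] at this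
  exact this.symm

end CoHiggs

/-! ### Sections of line bundles, and characteristic polynomials on invariant families -/

namespace CoHiggs

open Polynomial Filter Topology

/-- Liouville's theorem: `f` tends to `g 0` at infinity. -/
theorem eq_const_of_eq_comp_inv {f g : ℂ → ℂ} (hf : Differentiable ℂ f) (hg : Differentiable ℂ g)
    (h : ∀ z, z ≠ 0 → f z = g z⁻¹) (z : ℂ) : f z = g 0 := by
  apply hf.apply_eq_of_tendsto_cocompact
  have h1 : Tendsto (fun z : ℂ => g z⁻¹) (cocompact ℂ) (𝓝 (g 0)) := by
    rw [← Metric.cobounded_eq_cocompact]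
    exact hg.continuous.continuousAt.tendsto.comp tendsto_inv₀_cobounded
  refine h1.congr' ?_
  rw [← Metric.cobounded_eq_cocompact]
  filter_upwards [Bornology.eventually_ne_cobounded (0 : ℂ)] with z hz
  exact (h z hz).symm

/-- `H⁰(ℙ¹, 𝒪(d)) = 0` for `d < 0`. -/
theorem eq_zero_of_growth_neg {f g : ℂ → ℂ} (hf : Differentiable ℂ f) (hg : Differentiable ℂ g)
    {d : ℤ} (hd : d < 0) (h : ∀ z, z ≠ 0 → f z = z ^ d * g z⁻¹) (z : ℂ) : f z = 0 := by
  obtain ⟨e, rfl⟩ : ∃ e : ℕ, d = -((e + 1 : ℕ) : ℤ) := ⟨(-d - 1).toNat, by push_cast; omega⟩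
  -- The spare factor `w ^ (e + 1)` makes the function in the other chart vanish at `w = 0`.
  rw [eq_const_of_eq_comp_inv hf (g := fun w => w ^ (e + 1) * g w) (by fun_prop)]
  · simp
  · intro z hz
    rw [h z hz, zpow_neg, zpow_natCast, inv_pow]

/-- The sections of `𝒪(n)` over `ℙ¹` are the polynomials of degree at most `n`. -/
theorem exists_polynomial_of_growth (n : ℕ) {f g : ℂ → ℂ} (hf : Differentiable ℂ f)
    (hg : Differentiable ℂ g) (h : ∀ z, z ≠ 0 → f z = z ^ n * g z⁻¹) :
    ∃ p : ℂ[X], p.natDegree ≤ n ∧ ∀ z, f z = p.eval z := by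
  induction n generalizing f g with
  | zero =>
    refine ⟨C (g 0), by simp, fun z => ?_⟩
    rw [eq_const_of_eq_comp_inv hf hg (by simpa using h), eval_C]
  | succ n ih =>
    have hf1 : Differentiable ℂ (dslope f 0) := by
      rw [← differentiableOn_univ, Complex.differentiableOn_dslope univ_mem]
      exact hf.differentiableOn
    -- Splitting off the constant term: `(f z - f 0) / z` is a section of `𝒪(n)`, with this function
    -- in the chart `w`.
    obtain ⟨p, hp, hfp⟩ := ih hf1 (g := fun w => g w - f 0 * w ^ (n + 1)) (by fun_prop) (by
      intro z hz
      rw [dslope_of_ne _ hz, slope_def_field, h z hz, sub_zero,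
        div_eq_iff hz]
      have h1 : z ^ (n + 1) * z⁻¹ ^ (n + 1) = 1 := by rw [← mul_pow, mul_inv_cancel₀ hz, one_pow]
      linear_combination f 0 * h1)
    refine ⟨C (f 0) + X * p, ?_, fun z => ?_⟩
    · refine natDegree_add_le_of_degree_le (by simp) (natDegree_mul_le.trans ?_)
      have := natDegree_X_le (R := ℂ)
      omega
    · have := sub_smul_dslope f 0 z
      rw [sub_zero, smul_eq_mul, hfp] at this
      simp only [eval_add, eval_C, eval_mul, eval_X]
      rw [this]
      ring

theorem analyticAt_det {n : ℕ} {A : ℂ → Matrix (Fin n) (Fin n) ℂ} {z₀ : ℂ}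
    (hA : ∀ i j, AnalyticAt ℂ (fun z => A z i j) z₀) : AnalyticAt ℂ (fun z => (A z).det) z₀ := by
  simp only [Matrix.det_apply']
  refine Finset.analyticAt_fun_sum _ fun σ _ => analyticAt_const.mul ?_
  exact Finset.analyticAt_fun_prod _ fun i _ => hA _ _

theorem analyticAt_mul_apply {l m n : ℕ} {A : ℂ → Matrix (Fin l) (Fin m) ℂ}
    {B : ℂ → Matrix (Fin m) (Fin n) ℂ} {z₀ : ℂ}
    (hA : ∀ i j, AnalyticAt ℂ (fun z => A z i j) z₀)
    (hB : ∀ i j, AnalyticAt ℂ (fun z => B z i j) z₀) (i j) :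
    AnalyticAt ℂ (fun z => (A z * B z) i j) z₀ := by
  simp only [Matrix.mul_apply]
  exact Finset.analyticAt_fun_sum _ fun x _ => (hA _ _).mul (hB _ _)

theorem analyticAt_inv_apply {n : ℕ} {A : ℂ → Matrix (Fin n) (Fin n) ℂ} {z₀ : ℂ}
    (hA : ∀ i j, AnalyticAt ℂ (fun z => A z i j) z₀) (hdet : (A z₀).det ≠ 0) (i j) :
    AnalyticAt ℂ (fun z => (A z)⁻¹ i j) z₀ := by
  simp only [Matrix.inv_def, Matrix.smul_apply, Ring.inverse_eq_inv', smul_eq_mul,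
    Matrix.adjugate_apply]
  refine ((analyticAt_det hA).inv hdet).mul (analyticAt_det fun a b => ?_)
  by_cases h : a = j
  · subst h
    simp only [Matrix.updateRow_self]
    exact analyticAt_const
  · simp only [Matrix.updateRow_ne h]
    exact hA a b

theorem charpoly_coeff_eq_aeval {n : ℕ} (M : Matrix (Fin n) (Fin n) ℂ) (i : ℕ) :
    M.charpoly.coeff i = MvPolynomial.aeval (fun x : Fin n × Fin n => M x.1 x.2)
      ((Matrix.charpoly.univ ℂ (Fin n)).coeff i) :=
  (Matrix.charpoly.univ_coeff_eval₂Hom (Fin n) (algebraMap ℂ ℂ)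
    (fun x : Fin n × Fin n => M x.1 x.2) i).symm

theorem analyticAt_charpoly_coeff {n : ℕ} {A : ℂ → Matrix (Fin n) (Fin n) ℂ} {z₀ : ℂ}
    (hA : ∀ i j, AnalyticAt ℂ (fun z => A z i j) z₀) (i : ℕ) :
    AnalyticAt ℂ (fun z => (A z).charpoly.coeff i) z₀ := by
  simp only [charpoly_coeff_eq_aeval]
  exact AnalyticAt.aeval_mvPolynomial (f := fun z (x : Fin n × Fin n) => A z x.1 x.2)
    (fun x => hA x.1 x.2) _

theorem aeval_smul_of_isHomogeneous {σ : Type*} [Fintype σ] {p : MvPolynomial σ ℂ} {d : ℕ}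
    (hp : p.IsHomogeneous d) (c : ℂ) (x : σ → ℂ) :
    MvPolynomial.aeval (fun i => c * x i) p = c ^ d * MvPolynomial.aeval x p := by
  rw [MvPolynomial.aeval_def, MvPolynomial.aeval_def, MvPolynomial.eval₂_eq',
    MvPolynomial.eval₂_eq', Finset.mul_sum]
  refine Finset.sum_congr rfl fun e he => ?_
  have hd : ∑ i, e i = d := by
    rw [← hp (MvPolynomial.mem_support_iff.1 he), Finsupp.weight_apply,
      Finsupp.sum_fintype _ _ (by simp)]
    simp
  simp only [mul_pow, Finset.prod_mul_distrib, Finset.prod_pow_eq_pow_sum, hd]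
  ring

/-- The `i`-th coefficient is a homogeneous polynomial of degree `n - i` in the entries of the
matrix. -/
theorem charpoly_smul_coeff {n : ℕ} (c : ℂ) (M : Matrix (Fin n) (Fin n) ℂ) {i : ℕ} (hi : i ≤ n) :
    (c • M).charpoly.coeff i = c ^ (n - i) * M.charpoly.coeff i := by
  rw [charpoly_coeff_eq_aeval, charpoly_coeff_eq_aeval]
  exact aeval_smul_of_isHomogeneous (Matrix.charpoly.univ_coeff_isHomogeneous ℂ (Fin n) i (n - i)
    (by simp; omega)) c _

open Module.Basis in
/-- The characteristic polynomial of the restriction to an invariant subspace divides the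
characteristic polynomial. -/
theorem charpoly_restrict_dvd {K V : Type*} [Field K] [AddCommGroup V] [Module K V]
    [Module.Finite K V] (W : Submodule K V) (e : V →ₗ[K] V) (he : ∀ v ∈ W, e v ∈ W) :
    (e.restrict he).charpoly ∣ e.charpoly := by
  let bW := Module.finBasis K W
  let bQ := Module.finBasis K (V ⧸ W)
  -- In a basis adapted to `W`, the matrix of `e` is block upper triangular, with the restriction
  -- and the induced quotient map on the diagonal.
  let b := sumQuot bW bQ
  let A := LinearMap.toMatrix bW bW (e.restrict he)
  let B : Matrix _ _ K := Matrix.of fun i l => (b.repr (e (b (Sum.inr l)))) (Sum.inl i)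
  let D := LinearMap.toMatrix bQ bQ (W.mapQ W e he)
  suffices h : LinearMap.toMatrix b b e = Matrix.fromBlocks A B 0 D by
    rw [← LinearMap.charpoly_toMatrix e b, h, ← LinearMap.charpoly_toMatrix _ bW,
      Matrix.charpoly_fromBlocks_zero₂₁]
    exact dvd_mul_right _ _
  ext (i | i) (k | l)
  · simp only [b, sumQuot_inl, Matrix.fromBlocks_apply₁₁, A, LinearMap.toMatrix_apply]
    apply sumQuot_repr_inl_of_mem
  · simp [b, LinearMap.toMatrix_apply, Matrix.fromBlocks_apply₁₂, B]
  · suffices W.mkQ (e (bW k)) = 0 by simp [LinearMap.toMatrix_apply, b, this]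
    rw [← LinearMap.mem_ker, Submodule.ker_mkQ]
    exact he _ (Submodule.coe_mem (bW k))
  · simp only [LinearMap.toMatrix_apply, sumQuot_repr_inr, Matrix.fromBlocks_apply₂₂, b, D]
    rw [← sumQuot_inr bW bQ l, W.mapQ_apply]
    simp

/-- If `F` is a frame of the subspace `S`, and `A * F = F * M`, then `M` is the matrix of the
restriction of `A` to `S`. -/
theorem charpoly_restrict_eq {n k : ℕ} {S : Submodule ℂ (Fin n → ℂ)}
    {A : Matrix (Fin n) (Fin n) ℂ} {F : Matrix (Fin n) (Fin k) ℂ} {M : Matrix (Fin k) (Fin k) ℂ}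
    (hF : LinearIndependent ℂ F.col) (hS : Submodule.span ℂ (Set.range F.col) = S)
    (hA : ∀ v ∈ S, A.toLin' v ∈ S) (hM : A * F = F * M) :
    (A.toLin'.restrict hA).charpoly = M.charpoly := by
  subst hS
  let b := Module.Basis.span hF
  have : A.toLin'.restrict hA = Matrix.toLin b b M := by
    refine b.ext fun j => Subtype.ext ?_
    rw [Matrix.toLin_self, LinearMap.coe_restrict_apply]
    simp only [b, Module.Basis.span_apply, Submodule.coe_sum, Submodule.coe_smul]
    ext i
    have := congrFun (congrFun hM i) j
    simp only [Matrix.mul_apply] at this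
    simp only [Matrix.toLin'_apply, Matrix.mulVec, dotProduct, Matrix.col_apply, this,
      Finset.sum_apply, Pi.smul_apply, smul_eq_mul, mul_comm]
  rw [this, ← LinearMap.charpoly_toMatrix _ b, LinearMap.toMatrix_toLin]

/-- The matrix of the restriction to an invariant subspace with respect to a frame. -/
theorem exists_mul_eq_mul_of_invariant {n k : ℕ} {S : Submodule ℂ (Fin n → ℂ)}
    {A : Matrix (Fin n) (Fin n) ℂ} {F : Matrix (Fin n) (Fin k) ℂ}
    (hS : Submodule.span ℂ (Set.range F.col) = S) (hA : ∀ v ∈ S, A.toLin' v ∈ S) :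
    ∃ M : Matrix (Fin k) (Fin k) ℂ, A * F = F * M := by
  have h : ∀ j, ∃ c : Fin k → ℂ, ∑ i, c i • F.col i = A *ᵥ F.col j := by
    intro j
    rw [← Submodule.mem_span_range_iff_exists_fun, hS]
    exact hA _ (hS ▸ Submodule.subset_span ⟨j, rfl⟩)
  choose c hc using h
  refine ⟨Matrix.of fun i j => c j i, ?_⟩
  ext i j
  have := congrFun (hc j) i
  simp only [Finset.sum_apply, Pi.smul_apply, smul_eq_mul, Matrix.col_apply] at this
  simp only [Matrix.mul_apply, Matrix.of_apply]
  simp only [mul_comm (F _ _), this]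
  rfl

/-- The coefficients of the characteristic polynomial of the restriction of a holomorphic family
of matrices to a holomorphic family of invariant subspaces are entire. -/
theorem differentiable_charpoly_restrict_coeff {n k : ℕ} {fib : ℂ → Submodule ℂ (Fin n → ℂ)}
    (hfib : IsHolFamily k fib) {A : ℂ → Matrix (Fin n) (Fin n) ℂ}
    (hA : ∀ i j, Differentiable ℂ fun z => A z i j)
    (hinv : ∀ z, ∀ v ∈ fib z, (A z).toLin' v ∈ fib z) (i : ℕ) :
    Differentiable ℂ fun z => ((A z).toLin'.restrict (hinv z)).charpoly.coeff i := by
  intro z₀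
  obtain ⟨F, hF, hFz⟩ := hfib z₀
  -- With `L` a constant left inverse of the frame at `z₀`, `L * F z` stays invertible nearby, and
  -- the restriction has the matrix `(L * F z)⁻¹ * (L * (A z * F z))`, analytic in `z`.
  obtain ⟨L, hL⟩ : ∃ L : Matrix (Fin k) (Fin n) ℂ, L * F z₀ = 1 := by
    obtain ⟨g, hg⟩ := LinearMap.exists_leftInverse_of_injective (F z₀).toLin'
      (LinearMap.ker_eq_bot.2 (Matrix.mulVec_injective_iff.2 hFz.self_of_nhds.1))
    refine ⟨LinearMap.toMatrix' g, ?_⟩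
    rw [← LinearMap.toMatrix'_toLin' (F z₀), ← LinearMap.toMatrix'_comp, hg,
      LinearMap.toMatrix'_id]
  have hLF : ∀ i j, AnalyticAt ℂ (fun z => (L * F z) i j) z₀ :=
    analyticAt_mul_apply (A := fun _ => L) (fun _ _ => analyticAt_const) hF
  have hAa : ∀ i j, AnalyticAt ℂ (fun z => A z i j) z₀ := fun i j =>
    (hA i j).analyticAt z₀
  have hdet : (L * F z₀).det ≠ 0 := by simp [hL]
  have hN : ∀ i j, AnalyticAt ℂ (fun z => (L * (A z * F z)) i j) z₀ :=
    analyticAt_mul_apply (A := fun _ => L) (fun _ _ => analyticAt_const)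
      (analyticAt_mul_apply hAa hF)
  have hM : AnalyticAt ℂ (fun z => ((L * F z)⁻¹ * (L * (A z * F z))).charpoly.coeff i) z₀ :=
    analyticAt_charpoly_coeff (A := fun z => (L * F z)⁻¹ * (L * (A z * F z)))
      (analyticAt_mul_apply (A := fun z => (L * F z)⁻¹) (B := fun z => L * (A z * F z))
        (analyticAt_inv_apply hLF hdet) hN) i
  refine hM.differentiableAt.congr_of_eventuallyEq ?_
  filter_upwards [hFz, (analyticAt_det hLF).continuousAt.eventually_ne hdet] with z hz hdz
  obtain ⟨M, hAM⟩ := exists_mul_eq_mul_of_invariant hz.2 (hinv z)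
  rw [charpoly_restrict_eq hz.1 hz.2 (hinv z) hAM, hAM, ← Matrix.mul_assoc L,
    Matrix.nonsing_inv_mul_cancel_left _ _ (isUnit_iff_ne_zero.2 hdz)]

end CoHiggs

/-! ### Co-Higgs fields as polynomial matrices; factors from invariant subbundles -/

namespace CoHiggs

open Polynomial Filter Topology

/-- In coordinates, a co-Higgs field on `𝒪(m₁) ⊕ ⋯ ⊕ 𝒪(mᵣ)` is a matrix of sections of the bundles
`𝒪(mᵢ - mⱼ + 2)`. -/
theorem splitBundle_glue_iff {r : ℕ} (m : Fin r → ℤ) {z : ℂ} (hz : z ≠ 0)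
    (A B : Matrix (Fin r) (Fin r) ℂ) :
    B * (splitBundle m).g z = ((splitBundle m).twist 2).g z * A ↔
      ∀ i j, A i j = z ^ (m i - m j + 2) * B i j := by
  rw [← Matrix.ext_iff]
  refine forall_congr' fun i => forall_congr' fun j => ?_
  simp only [splitBundle, HolBundle.twist, Matrix.mul_diagonal, Matrix.smul_mul,
    Matrix.smul_apply, Matrix.diagonal_mul, smul_eq_mul]
  rw [zpow_add₀ hz, zpow_sub₀ hz, zpow_neg, zpow_neg, zpow_neg]
  have h1 := zpow_ne_zero (m i) hz
  have h2 := zpow_ne_zero (m j) hz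
  have h3 := zpow_ne_zero 2 hz
  field_simp
  constructor <;> intro h <;> linear_combination -h

theorem higgs_apply {r : ℕ} {m : Fin r → ℤ} (φ : HiggsField (splitBundle m)) {z : ℂ}
    (hz : z ≠ 0) (i j : Fin r) : φ.1.1 z i j = z ^ (m i - m j + 2) * φ.1.2 z⁻¹ i j :=
  (splitBundle_glue_iff m hz _ _).1 (φ.2.2.2 z hz) i j

theorem higgs_apply' {r : ℕ} {m : Fin r → ℤ} (φ : HiggsField (splitBundle m)) {w : ℂ}
    (hw : w ≠ 0) (i j : Fin r) : φ.1.2 w i j = w ^ (m i - m j + 2) * φ.1.1 w⁻¹ i j := by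
  rw [higgs_apply φ (inv_ne_zero hw), inv_inv, inv_zpow, mul_inv_cancel_left₀ (zpow_ne_zero _ hw)]

theorem higgs_apply_eq_zero {r : ℕ} {m : Fin r → ℤ} (φ : HiggsField (splitBundle m))
    {i j : Fin r} (h : m i - m j + 2 < 0) (z : ℂ) : φ.1.1 z i j = 0 :=
  eq_zero_of_growth_neg (φ.2.1 i j) (φ.2.2.1 i j) h (fun _ hz => higgs_apply φ hz i j) z

theorem higgs_apply_eq_zero' {r : ℕ} {m : Fin r → ℤ} (φ : HiggsField (splitBundle m))
    {i j : Fin r} (h : m i - m j + 2 < 0) (w : ℂ) : φ.1.2 w i j = 0 :=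
  eq_zero_of_growth_neg (φ.2.2.1 i j) (φ.2.1 i j) h (fun _ hz => higgs_apply' φ hz i j) w

theorem exists_higgs_entry {r : ℕ} {m : Fin r → ℤ} (φ : HiggsField (splitBundle m))
    (i j : Fin r) : ∃ p : ℂ[X], p.natDegree ≤ (m i - m j + 2).toNat ∧
      ∀ z, φ.1.1 z i j = p.eval z := by
  rcases lt_or_ge (m i - m j + 2) 0 with h | h
  · exact ⟨0, by simp, fun z => by rw [higgs_apply_eq_zero φ h, eval_zero]⟩
  · refine exists_polynomial_of_growth _ (φ.2.1 i j) (φ.2.2.1 i j) fun z hz => ?_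
    rw [higgs_apply φ hz, ← zpow_natCast, Int.toNat_of_nonneg h]

/-- The entries of a co-Higgs field on `𝒪(m₁) ⊕ ⋯ ⊕ 𝒪(mᵣ)` as polynomials in `z`. -/
noncomputable def higgsEntry {r : ℕ} (m : Fin r → ℤ) (i j : Fin r) :
    HiggsField (splitBundle m) →ₗ[ℂ] ℂ[X] where
  toFun φ := (exists_higgs_entry φ i j).choose
  -- The chosen polynomial is determined by its values, which makes the choice linear.
  map_add' φ ψ := Polynomial.funext fun z => by
    rw [eval_add, ← (exists_higgs_entry (φ + ψ) i j).choose_spec.2 z,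
      ← (exists_higgs_entry φ i j).choose_spec.2 z, ← (exists_higgs_entry ψ i j).choose_spec.2 z]
    rfl
  map_smul' c φ := Polynomial.funext fun z => by
    rw [RingHom.id_apply, eval_smul, ← (exists_higgs_entry (c • φ) i j).choose_spec.2 z,
      ← (exists_higgs_entry φ i j).choose_spec.2 z]
    rfl

theorem eval_higgsEntry {r : ℕ} {m : Fin r → ℤ} (φ : HiggsField (splitBundle m)) (i j : Fin r)
    (z : ℂ) : (higgsEntry m i j φ).eval z = φ.1.1 z i j :=
  ((exists_higgs_entry φ i j).choose_spec.2 z).symm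

theorem natDegree_higgsEntry_le {r : ℕ} {m : Fin r → ℤ} (φ : HiggsField (splitBundle m))
    (i j : Fin r) : (higgsEntry m i j φ).natDegree ≤ (m i - m j + 2).toNat :=
  (exists_higgs_entry φ i j).choose_spec.1

/-- A co-Higgs field on `𝒪(m₁) ⊕ ⋯ ⊕ 𝒪(mᵣ)` as a matrix of polynomials in `z`. -/
noncomputable def higgsMatrix {r : ℕ} {m : Fin r → ℤ} (φ : HiggsField (splitBundle m)) :
    Matrix (Fin r) (Fin r) ℂ[X] :=
  Matrix.of fun i j => higgsEntry m i j φ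

theorem map_eval_higgsMatrix {r : ℕ} {m : Fin r → ℤ} (φ : HiggsField (splitBundle m)) (z : ℂ) :
    (higgsMatrix φ).map (evalRingHom z) = φ.1.1 z := by
  ext i j
  exact eval_higgsEntry φ i j z

/-- The transition rule for the characteristic polynomial of the restriction of a co-Higgs field to
an invariant subbundle. -/
theorem charpoly_restrict_coeff_glue {n k : ℕ} {E : HolBundle n} (U : Subbundle E k)
    (φ : HiggsField E) (h₀ : ∀ z, ∀ v ∈ U.fib0 z, (φ.1.1 z).toLin' v ∈ U.fib0 z)
    (h₁ : ∀ w, ∀ v ∈ U.fib1 w, (φ.1.2 w).toLin' v ∈ U.fib1 w) {i : ℕ} (hi : i ≤ k) {z : ℂ}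
    (hz : z ≠ 0) :
    ((φ.1.1 z).toLin'.restrict (h₀ z)).charpoly.coeff i = z ^ (2 * (k - i)) *
      ((φ.1.2 z⁻¹).toLin'.restrict (h₁ z⁻¹)).charpoly.coeff i := by
  obtain ⟨F, -, hF⟩ := U.holo0 z
  obtain ⟨hli, hspan⟩ := hF.self_of_nhds
  obtain ⟨M, hM⟩ := exists_mul_eq_mul_of_invariant hspan (h₀ z)
  have hcol : (E.g z * F z).col = (E.g z).toLin' ∘ (F z).col := by
    funext j
    ext i
    rfl
  have hinj : LinearMap.ker (E.g z).toLin' = ⊥ :=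
    LinearMap.ker_eq_bot.2 (Matrix.mulVec_injective_of_isUnit
      ((Matrix.isUnit_iff_isUnit_det _).2 (isUnit_iff_ne_zero.2 (E.det_ne_zero z hz))))
  have hli' : LinearIndependent ℂ (E.g z * F z).col := by
    rw [hcol]
    exact hli.map' _ hinj
  have hspan' : Submodule.span ℂ (Set.range (E.g z * F z).col) = U.fib1 z⁻¹ := by
    rw [hcol, Set.range_comp, Submodule.span_image, hspan, U.glue z hz]
  -- In the transported frame the matrix of the restriction is `M` scaled by the transition function
  -- `z ^ (-2)` of `𝒪(2)`; the `i`-th coefficient then scales by its `(k - i)`-th power.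
  have hM' : φ.1.2 z⁻¹ * (E.g z * F z) = E.g z * F z * (z ^ (-2 : ℤ) • M) := by
    have htw : φ.1.2 z⁻¹ * E.g z = (z ^ (-2 : ℤ) • E.g z) * φ.1.1 z := φ.2.2.2 z hz
    rw [← Matrix.mul_assoc, htw, Matrix.mul_assoc, hM]
    simp only [Matrix.smul_mul, Matrix.mul_smul, Matrix.mul_assoc]
  rw [charpoly_restrict_eq hli hspan (h₀ z) hM, charpoly_restrict_eq hli' hspan' (h₁ _) hM',
    charpoly_smul_coeff _ _ hi, ← mul_assoc, pow_mul, ← mul_pow, zpow_neg]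
  have : z ^ 2 * (z ^ (2 : ℤ))⁻¹ = 1 := by
    rw [← zpow_natCast]
    exact mul_inv_cancel₀ (zpow_ne_zero _ hz)
  rw [this, one_pow, one_mul]

theorem natDegree_charpoly_restrict {n k : ℕ} {fib : ℂ → Submodule ℂ (Fin n → ℂ)}
    (hfib : IsHolFamily k fib) {z : ℂ} {A : Matrix (Fin n) (Fin n) ℂ}
    (hA : ∀ v ∈ fib z, A.toLin' v ∈ fib z) :
    (A.toLin'.restrict hA).charpoly.natDegree = k := by
  obtain ⟨F, -, hF⟩ := hfib z
  obtain ⟨hli, hspan⟩ := hF.self_of_nhds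
  rw [LinearMap.charpoly_natDegree, ← hspan, finrank_span_eq_card hli, Fintype.card_fin]

/-- A bivariate polynomial can be recovered from its specializations. -/
theorem exists_monic_map_eval_eq {k : ℕ} {N : ℕ} {q : ℂ → ℂ[X]} (hm : ∀ z, (q z).Monic)
    (hd : ∀ z, (q z).natDegree = k)
    (hp : ∀ i ≤ k, ∃ p : ℂ[X], p.natDegree ≤ N ∧ ∀ z, (q z).coeff i = p.eval z) :
    ∃ Q : ℂ[X][X], Q.Monic ∧ Q.natDegree = k ∧ (∀ i, (Q.coeff i).natDegree ≤ N) ∧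
      ∀ z, Q.map (evalRingHom z) = q z := by
  have hp' : ∀ i, ∃ p : ℂ[X], p.natDegree ≤ N ∧ ∀ z, (q z).coeff i = p.eval z := by
    intro i
    rcases le_or_gt i k with h | h
    · exact hp i h
    · exact ⟨0, by simp, fun z => by
        rw [coeff_eq_zero_of_natDegree_lt (by rw [hd]; exact h), eval_zero]⟩
  choose p hpN hpq using hp'
  let Q : ℂ[X][X] := ∑ i ∈ Finset.range (k + 1), monomial i (p i)
  have hcoeff : ∀ i, Q.coeff i = p i := by
    intro i
    simp only [Q, finsetSum_coeff, coeff_monomial, Finset.sum_ite_eq', Finset.mem_range]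
    split_ifs with hi
    · rfl
    · refine Polynomial.funext fun z => ?_
      rw [← hpq, coeff_eq_zero_of_natDegree_lt (by rw [hd]; omega), eval_zero]
  have hdeg : Q.natDegree ≤ k := by
    refine natDegree_sum_le_of_forall_le _ _ fun i hi => (natDegree_monomial_le _).trans ?_
    exact Nat.lt_succ_iff.1 (Finset.mem_range.1 hi)
  have hk : Q.coeff k = 1 := by
    refine Polynomial.funext fun z => ?_
    rw [hcoeff, ← hpq, eval_one]
    exact hd z ▸ hm z
  have hQm := monic_of_natDegree_le_of_coeff_eq_one k hdeg hk
  refine ⟨Q, hQm, ?_, fun i => hcoeff i ▸ hpN i, fun z => ?_⟩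
  · exact le_antisymm hdeg (le_natDegree_of_ne_zero (by rw [hk]; exact one_ne_zero))
  · ext i
    rw [coeff_map, hcoeff, hpq]
    rfl

/-- The remainder modulo the monic `Q` commutes with evaluation at `z`, and a polynomial vanishing
on all of `ℂ` is zero. -/
theorem dvd_of_map_eval_dvd {P Q : ℂ[X][X]} (hQ : Q.Monic)
    (h : ∀ z, Q.map (evalRingHom z) ∣ P.map (evalRingHom z)) : Q ∣ P := by
  rw [← modByMonic_eq_zero_iff_dvd hQ]
  ext1 i
  refine Polynomial.funext fun z => ?_
  have := (modByMonic_eq_zero_iff_dvd (hQ.map (evalRingHom z))).2 (h z)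
  rw [← map_modByMonic _ hQ] at this
  simpa [coeff_map] using congrArg (fun p => p.coeff i) this

/-- An invariant subbundle gives rise to a factor of the characteristic polynomial. -/
theorem exists_factor_of_isInvariant {r k : ℕ} {m : Fin r → ℤ} {φ : HiggsField (splitBundle m)}
    {U : Subbundle (splitBundle m) k} (hU : U.IsInvariant φ) :
    ∃ Q : ℂ[X][X], Q.Monic ∧ Q.natDegree = k ∧ (∀ i, (Q.coeff i).natDegree ≤ 2 * k) ∧
      Q ∣ (higgsMatrix φ).charpoly := by
  have h₀ : ∀ z, ∀ v ∈ U.fib0 z, (φ.1.1 z).toLin' v ∈ U.fib0 z := hU.1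
  have h₁ : ∀ w, ∀ v ∈ U.fib1 w, (φ.1.2 w).toLin' v ∈ U.fib1 w := hU.2
  obtain ⟨Q, hQm, hQd, hQN, hQ⟩ := exists_monic_map_eval_eq (k := k) (N := 2 * k)
    (q := fun z => ((φ.1.1 z).toLin'.restrict (h₀ z)).charpoly)
    (fun z => LinearMap.charpoly_monic _)
    (fun z => natDegree_charpoly_restrict U.holo0 (h₀ z)) (by
      intro i hi
      obtain ⟨p, hp, hpq⟩ := exists_polynomial_of_growth (2 * (k - i))
        (differentiable_charpoly_restrict_coeff U.holo0 φ.2.1 h₀ i)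
        (differentiable_charpoly_restrict_coeff U.holo1 φ.2.2.1 h₁ i)
        (fun z hz => charpoly_restrict_coeff_glue U φ h₀ h₁ hi hz)
      exact ⟨p, by omega, hpq⟩)
  refine ⟨Q, hQm, hQd, hQN, dvd_of_map_eval_dvd hQm fun z => ?_⟩
  rw [hQ, ← Matrix.charpoly_map, map_eval_higgsMatrix, ← Matrix.charpoly_toLin']
  exact charpoly_restrict_dvd _ _ (h₀ z)

end CoHiggs

/-! ### The cyclic co-Higgs field and the generic absence of invariant subbundles -/

namespace CoHiggs

open Polynomial

/-- The companion matrix of `Y ^ r - x`. -/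
def cyclicMatrix {A : Type*} [CommRing A] (r : ℕ) (x : A) : Matrix (Fin r) (Fin r) A :=
  Matrix.of fun i j => if i = finRotate r j then (if j.val + 1 = r then x else 1) else 0

theorem map_cyclicMatrix {A B : Type*} [CommRing A] [CommRing B] (f : A →+* B) (r : ℕ) (x : A) :
    (cyclicMatrix r x).map f = cyclicMatrix r (f x) := by
  ext i j
  simp only [cyclicMatrix, Matrix.map_apply, Matrix.of_apply]
  split_ifs <;> simp

theorem val_finRotate_of_ne {r : ℕ} {j : Fin r} (h : j.val + 1 ≠ r) :
    (finRotate r j).val = j.val + 1 := by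
  cases r with
  | zero => exact j.elim0
  | succ n => exact coe_finRotate_of_ne_last fun h' => h (by simp [h'])

theorem val_finRotate_of_eq {r : ℕ} {j : Fin r} (h : j.val + 1 = r) :
    (finRotate r j).val = 0 := by
  cases r with
  | zero => exact j.elim0
  | succ n =>
    have : j = Fin.last n := Fin.ext (by simpa using h)
    simp [this]

/-- For `x = 0` the matrix is strictly lower triangular. -/
theorem charpoly_cyclicMatrix_zero {A : Type*} [CommRing A] (r : ℕ) :
    (cyclicMatrix r (0 : A)).charpoly = X ^ r := by
  have hent : ∀ i j : Fin r, i ≤ j → cyclicMatrix r (0 : A) i j = 0 := by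
    intro i j hij
    simp only [cyclicMatrix, Matrix.of_apply]
    split_ifs with h1 h2
    · rfl
    · have := val_finRotate_of_ne h2
      rw [← h1] at this
      have : i.val ≤ j.val := hij
      omega
    · rfl
  rw [← Matrix.charpoly_transpose, Matrix.charpoly_of_isUpperTriangular]
  · simp [hent _ _ le_rfl]
  · intro i j hij
    exact hent j i hij.le

/-- The matrix is a diagonal matrix with permuted rows. The sign is left open, as Eisenstein's
criterion does not depend on it. -/
theorem det_cyclicMatrix {A : Type*} [CommRing A] {r : ℕ} (hr : 0 < r) (x : A) :
    ∃ u : ℤˣ, (cyclicMatrix r x).det = ((u : ℤ) : A) * x := by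
  have : cyclicMatrix r x = (Matrix.diagonal fun j : Fin r => if j.val + 1 = r then x else 1
      ).submatrix (finRotate r).symm id := by
    ext i j
    rw [cyclicMatrix, Matrix.of_apply, Matrix.submatrix_apply, id]
    by_cases h : i = finRotate r j
    · rw [if_pos h, h, Equiv.symm_apply_apply, Matrix.diagonal_apply_eq]
    · rw [if_neg h, Matrix.diagonal_apply_ne _ fun h' => h ((Equiv.symm_apply_eq _).1 h')]
  refine ⟨Equiv.Perm.sign (finRotate r).symm, ?_⟩
  rw [this, Matrix.det_permute, Matrix.det_diagonal, Finset.prod_eq_single ⟨r - 1, by omega⟩]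
  · rw [if_pos (by simp; omega)]
  · intro b _ hb
    rw [if_neg]
    intro h
    exact hb (Fin.ext (by simp; omega))
  · simp

/-- The characteristic polynomial `Y ^ r - X` of the cyclic matrix is irreducible over every domain. -/
theorem irreducible_charpoly_cyclicMatrix {D : Type*} [CommRing D] [IsDomain D] {r : ℕ}
    (hr : 0 < r) : Irreducible (cyclicMatrix r (X : D[X])).charpoly := by
  have hdeg : (cyclicMatrix r (X : D[X])).charpoly.natDegree = r := by
    rw [Matrix.charpoly_natDegree_eq_dim, Fintype.card_fin]
  have hmon := Matrix.charpoly_monic (cyclicMatrix r (X : D[X]))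
  have hprime : (Ideal.span {(X : D[X])}).IsPrime :=
    (Ideal.span_singleton_prime X_ne_zero).2 prime_X
  -- Eisenstein at `(X)`: setting `X = 0` leaves `Y ^ r`, and the constant term is, up to sign, the
  -- determinant `±X`, not divisible by `X ^ 2`.
  refine IsEisensteinAt.irreducible (𝓟 := Ideal.span {(X : D[X])}) ⟨?_, ?_, ?_⟩ hprime
    hmon.isPrimitive (by omega)
  · rw [hmon.leadingCoeff]
    exact fun h => hprime.ne_top ((Ideal.eq_top_iff_one _).2 h)
  · intro n hn
    rw [hdeg] at hn
    rw [Ideal.mem_span_singleton, X_dvd_iff]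
    have : (cyclicMatrix r (X : D[X])).charpoly.map (evalRingHom 0) = X ^ r := by
      rw [← Matrix.charpoly_map, map_cyclicMatrix, coe_evalRingHom, eval_X,
        charpoly_cyclicMatrix_zero]
    have := congrArg (fun p => p.coeff n) this
    simpa [coeff_map, coeff_X_pow, hn.ne, coeff_zero_eq_eval_zero] using this
  · rw [Ideal.span_singleton_pow, Ideal.mem_span_singleton]
    intro h
    obtain ⟨u, hu⟩ := det_cyclicMatrix hr (X : D[X])
    have h1 : X ^ 2 ∣ (cyclicMatrix r (X : D[X])).det := by
      rw [Matrix.det_eq_sign_charpoly_coeff]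
      exact h.mul_left _
    have h2 : (X : D[X]) ^ 2 ∣ X := by
      rw [hu] at h1
      rcases Int.units_eq_one_or u with rfl | rfl <;> simpa using h1
    have h3 := (X_pow_dvd_iff.1 h2) 1 one_lt_two
    simp at h3

theorem natDegree_eq_of_monic_dvd_irreducible {A : Type*} [CommRing A] [IsDomain A] {P Q : A[X]}
    (hP : Irreducible P) (hQ : Q.Monic) (h : Q ∣ P) : Q.natDegree = 0 ∨
      Q.natDegree = P.natDegree := by
  obtain ⟨S, rfl⟩ := h
  rcases hP.isUnit_or_isUnit rfl with hu | hu
  · exact Or.inl (natDegree_eq_zero_of_isUnit hu)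
  · right
    rw [natDegree_mul hQ.ne_zero hu.ne_zero, natDegree_eq_zero_of_isUnit hu, add_zero]

/-- If the weights have no gap larger than `2`, there is a co-Higgs field whose matrix is the
companion matrix of `Y ^ r - X`. -/
theorem exists_higgsMatrix_eq_cyclicMatrix {r : ℕ} {m : Fin r → ℤ} (hm : Antitone m)
    (hgap : ∀ (i : ℕ) (hi : i + 1 < r), m ⟨i, Nat.lt_of_succ_lt hi⟩ ≤ m ⟨i + 1, hi⟩ + 2) :
    ∃ φ : HiggsField (splitBundle m), higgsMatrix φ = cyclicMatrix r X := by
  -- An entry `1` or `z` of a section of `𝒪(d)` becomes `w ^ d` or `w ^ (d - 1)` in the other chart.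
  -- On the subdiagonal `d ≥ 0` is the gap condition; in the corner `d ≥ 2` by monotonicity.
  let e : Fin r → ℕ := fun j =>
    (m (finRotate r j) - m j + 2 - if j.val + 1 = r then 1 else 0).toNat
  have he : ∀ j, (e j : ℤ) = m (finRotate r j) - m j + 2 - if j.val + 1 = r then 1 else 0 := by
    intro j
    refine Int.toNat_of_nonneg ?_
    split_ifs with h
    · have : m j ≤ m (finRotate r j) :=
        hm (by rw [Fin.le_def, val_finRotate_of_eq h]; exact Nat.zero_le _)
      omega
    · have hj := val_finRotate_of_ne h
      have h1 := hgap j.val (by omega)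
      have h2 : (⟨j.val + 1, by omega⟩ : Fin r) = finRotate r j := Fin.ext hj.symm
      rw [h2] at h1
      change m j ≤ _ at h1
      omega
  let f₁ : ℂ → Matrix (Fin r) (Fin r) ℂ := fun w => Matrix.of fun i j =>
    if i = finRotate r j then w ^ e j else 0
  refine ⟨⟨(fun z => cyclicMatrix r z, f₁), ?_, ?_, ?_⟩, ?_⟩
  · intro i j
    simp only [cyclicMatrix, Matrix.of_apply]
    split_ifs <;> fun_prop
  · intro i j
    simp only [f₁, Matrix.of_apply]
    split_ifs <;> fun_prop
  · intro z hz
    rw [splitBundle_glue_iff m hz]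
    intro i j
    simp only [cyclicMatrix, f₁, Matrix.of_apply]
    by_cases h : i = finRotate r j
    · subst h
      rw [if_pos rfl, if_pos rfl, inv_pow, ← zpow_natCast, ← zpow_neg, ← zpow_add₀ hz, he]
      split_ifs <;> ring_nf <;> simp
    · rw [if_neg h, if_neg h, mul_zero]
  · ext1 i j
    refine Polynomial.funext fun z => ?_
    refine (eval_higgsEntry _ i j z).trans ?_
    have := congrFun (congrFun (map_cyclicMatrix (evalRingHom z) r (X : ℂ[X])) i) j
    rw [Matrix.map_apply, coe_evalRingHom, eval_X] at this
    exact this.symm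

/-- The algebra of polynomial functions on the space of co-Higgs fields on
`𝒪(m₁) ⊕ ⋯ ⊕ 𝒪(mᵣ)`. -/
noncomputable abbrev higgsPoly {r : ℕ} (m : Fin r → ℤ) :
    Subalgebra ℂ (HiggsField (splitBundle m) → ℂ) :=
  polyFunctions (HiggsField (splitBundle m))

/-- The universal co-Higgs field: its entries are polynomials in `z` whose coefficients are
polynomial functions on the space of co-Higgs fields. -/
theorem exists_universal_higgsMatrix {r : ℕ} (m : Fin r → ℤ) :
    ∃ G : Matrix (Fin r) (Fin r) (higgsPoly m)[X],
      ∀ φ, G.map (mapRingHom (evalAt (higgsPoly m) φ : higgsPoly m →+* ℂ)) = higgsMatrix φ := by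
  -- Each coefficient of each entry is a linear form in `φ`; the degree bound on the entries is
  -- uniform in `φ`, so finitely many monomials suffice.
  have hmem : ∀ i j d, (fun φ => (higgsEntry m i j φ).coeff d) ∈
      polyFunctions (HiggsField (splitBundle m)) := fun i j d =>
    Algebra.subset_adjoin ⟨(lcoeff ℂ d).comp (higgsEntry m i j), rfl⟩
  refine ⟨Matrix.of fun i j => ∑ d ∈ Finset.range ((m i - m j + 2).toNat + 1),
    monomial d ⟨_, hmem i j d⟩, fun φ => ?_⟩
  ext1 i j
  rw [Matrix.map_apply, Matrix.of_apply, map_sum]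
  conv_rhs => rw [higgsMatrix, Matrix.of_apply, (higgsEntry m i j φ).as_sum_range'
    _ (Nat.lt_succ_of_le (natDegree_higgsEntry_le φ i j))]
  refine Finset.sum_congr rfl fun d _ => ?_
  rw [coe_mapRingHom, map_monomial]
  rfl

/-- For a generic co-Higgs field there is no invariant subbundle of rank `k`. -/
theorem exists_polyFunction_forall_not_isInvariant {r : ℕ} {m : Fin r → ℤ} (hr : 0 < r)
    {φ₀ : HiggsField (splitBundle m)} (hφ₀ : higgsMatrix φ₀ = cyclicMatrix r X)
    {k : ℕ} (hk : 0 < k) (hkr : k < r) :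
    ∃ f ∈ polyFunctions (HiggsField (splitBundle m)), f φ₀ ≠ 0 ∧
      ∀ φ, f φ ≠ 0 → ∀ U : Subbundle (splitBundle m) k, ¬ U.IsInvariant φ := by
  obtain ⟨G, hG⟩ := exists_universal_higgsMatrix m
  have hev : ∀ φ, bimap (evalAt (higgsPoly m) φ : higgsPoly m →+* ℂ) G.charpoly =
      (higgsMatrix φ).charpoly := by
    intro φ
    rw [← hG φ]
    exact (Matrix.charpoly_map G (mapRingHom (evalAt (higgsPoly m) φ : higgsPoly m →+* ℂ))).symm
  obtain ⟨f, hf₀, hf⟩ := exists_separating_function (higgsPoly m)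
    (Matrix.charpoly_monic G) φ₀ k (2 * k) (by
      -- At `φ₀` the characteristic polynomial remains irreducible over `D`, so a monic factor has
      -- degree `0` or `r`, never `k`.
      intro D _ _ τ Q hQ hQk hdvd
      have h1 : bimap (τ.comp (evalAt (higgsPoly m) φ₀ : higgsPoly m →+* ℂ)) G.charpoly =
          (cyclicMatrix r (X : D[X])).charpoly := by
        rw [← bimap_comp, hev, hφ₀, bimap, coe_mapRingHom, ← Matrix.charpoly_map,
          map_cyclicMatrix, coe_mapRingHom, map_X]
      rw [h1] at hdvd
      have := natDegree_eq_of_monic_dvd_irreducible (irreducible_charpoly_cyclicMatrix hr) hQ hdvd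
      rw [Matrix.charpoly_natDegree_eq_dim, Fintype.card_fin] at this
      omega)
  refine ⟨f.1, f.2, hf₀, fun φ hφ U hU => hφ (hf φ ?_)⟩
  obtain ⟨Q, h1, h2, h3, h4⟩ := exists_factor_of_isInvariant hU
  exact ⟨Q, h1, h2, h3, by rw [hev]; exact h4⟩

theorem exists_zariskiOpen_forall_not_isInvariant {r : ℕ} {m : Fin r → ℤ} (hr : 0 < r)
    (hm : Antitone m)
    (hgap : ∀ (i : ℕ) (hi : i + 1 < r), m ⟨i, Nat.lt_of_succ_lt hi⟩ ≤ m ⟨i + 1, hi⟩ + 2) :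
    ∃ S : Set (HiggsField (splitBundle m)), IsZariskiOpen S ∧ S.Nonempty ∧
      ∀ φ ∈ S, ∀ k : ℕ, 0 < k → k < r → ∀ U : Subbundle (splitBundle m) k, ¬ U.IsInvariant φ := by
  obtain ⟨φ₀, hφ₀⟩ := exists_higgsMatrix_eq_cyclicMatrix hm hgap
  have h : ∀ k : ℕ, ∃ f ∈ polyFunctions (HiggsField (splitBundle m)), f φ₀ ≠ 0 ∧
      ∀ φ, f φ ≠ 0 → 0 < k → k < r → ∀ U : Subbundle (splitBundle m) k, ¬ U.IsInvariant φ := by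
    intro k
    by_cases hk : 0 < k ∧ k < r
    · obtain ⟨f, h1, h2, h3⟩ := exists_polyFunction_forall_not_isInvariant hr hφ₀ hk.1 hk.2
      exact ⟨f, h1, h2, fun φ hφ _ _ => h3 φ hφ⟩
    · exact ⟨1, one_mem _, one_ne_zero, fun φ _ h1 h2 => absurd ⟨h1, h2⟩ hk⟩
  choose f hf hf₀ hfU using h
  -- One function for each rank; none vanishes at `φ₀`, so neither does their product.
  refine ⟨{φ | (∏ k ∈ Finset.range r, f k) φ ≠ 0}, ⟨{∏ k ∈ Finset.range r, f k}, ?_, ?_⟩,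
    ⟨φ₀, ?_⟩, ?_⟩
  · rw [Set.singleton_subset_iff]
    exact Subalgebra.prod_mem _ fun k _ => hf k
  · ext φ
    simp
  · rw [Set.mem_ofPred_eq, Finset.prod_apply]
    exact Finset.prod_ne_zero_iff.2 fun k _ => hf₀ k
  · intro φ hφ k hk hkr
    rw [Set.mem_ofPred_eq, Finset.prod_apply] at hφ
    exact hfU k φ (Finset.prod_ne_zero_iff.1 hφ k (Finset.mem_range.2 hkr)) hk hkr

end CoHiggs

/-! ### Degrees of split bundles and the destabilizing subbundle -/

namespace CoHiggs

theorem degree_splitBundle {r : ℕ} (m : Fin r → ℤ) :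
    (splitBundle m).degree = ∑ i, (m i : ℝ) := by
  have h : ∀ z ∈ Metric.sphere (0 : ℂ) 1,
      logDeriv (fun u => ((splitBundle m).g u).det) z = (-∑ i, (m i : ℂ)) • (z - 0)⁻¹ := by
    intro z hz
    have hz0 : z ≠ 0 := ne_zero_of_mem_unit_sphere ⟨z, hz⟩
    simp only [splitBundle, Matrix.det_diagonal]
    rw [logDeriv_prod (s := Finset.univ) (f := fun (i : Fin r) (u : ℂ) => u ^ (-m i)) (fun i _ => zpow_ne_zero _ hz0)
      (fun i _ => differentiableAt_zpow.2 (Or.inl hz0))]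
    simp only [logDeriv_zpow, sub_zero, smul_eq_mul]
    push_cast
    rw [← Finset.sum_div, Finset.sum_neg_distrib, div_eq_mul_inv]
  rw [HolBundle.degree, circleIntegral.integral_congr zero_le_one h,
    circleIntegral.integral_smul, circleIntegral.integral_sub_center_inv _ one_ne_zero,
    smul_eq_mul]
  have h2 : (2 * (Real.pi : ℂ) * Complex.I)⁻¹ *
      ((-∑ i, (m i : ℂ)) * (2 * Real.pi * Complex.I)) = ((-∑ i, (m i : ℝ) : ℝ) : ℂ) := by
    have := Complex.two_pi_I_ne_zero
    push_cast
    field_simp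
  rw [h2, Complex.ofReal_re, neg_neg]

/-- The matrix of the inclusion of the first `k` coordinates. -/
def firstCoords (n k : ℕ) : Matrix (Fin n) (Fin k) ℂ :=
  Matrix.of fun a b => if a.val = b.val then 1 else 0

theorem transpose_firstCoords_mul {n k : ℕ} (hk : k ≤ n) :
    (firstCoords n k)ᵀ * firstCoords n k = 1 := by
  ext a b
  rw [Matrix.mul_apply, Finset.sum_eq_single (Fin.castLE hk a)]
  · simp [firstCoords, Matrix.one_apply, Fin.ext_iff]
  · intro c _ hc
    have : c.val ≠ a.val := fun h => hc (Fin.ext h)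
    simp [firstCoords, this]
  · simp

theorem mem_range_firstCoords {n k : ℕ} (hk : k ≤ n) (v : Fin n → ℂ) :
    v ∈ LinearMap.range (firstCoords n k).toLin' ↔ ∀ a : Fin n, k ≤ a.val → v a = 0 := by
  constructor
  · rintro ⟨u, rfl⟩ a ha
    rw [Matrix.toLin'_apply, Matrix.mulVec, dotProduct]
    refine Finset.sum_eq_zero fun b _ => ?_
    have : a.val ≠ b.val := by omega
    simp [firstCoords, this]
  · intro h
    refine ⟨fun b => v (Fin.castLE hk b), ?_⟩
    ext a
    rw [Matrix.toLin'_apply, Matrix.mulVec, dotProduct]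
    by_cases ha : a.val < k
    · rw [Finset.sum_eq_single ⟨a.val, ha⟩]
      · simp [firstCoords]
      · intro b _ hb
        have : a.val ≠ b.val := fun h => hb (Fin.ext h.symm)
        simp [firstCoords, this]
      · simp
    · rw [h a (not_lt.1 ha)]
      refine Finset.sum_eq_zero fun b _ => ?_
      have : a.val ≠ b.val := by omega
      simp [firstCoords, this]

theorem isHolFamily_range_firstCoords {n k : ℕ} (hk : k ≤ n) :
    IsHolFamily k fun _ => LinearMap.range (firstCoords n k).toLin' := by
  refine fun z₀ => ⟨fun _ => firstCoords n k, fun _ _ => analyticAt_const,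
    Filter.Eventually.of_forall fun z => ⟨?_, ?_⟩⟩
  · rw [← Matrix.mulVec_injective_iff]
    intro u v huv
    have := congrArg ((firstCoords n k)ᵀ *ᵥ ·) huv
    simpa [Matrix.mulVec_mulVec, transpose_firstCoords_mul hk] using this
  · exact (Matrix.range_mulVecLin _).symm

/-- The subbundle `𝒪(m₁) ⊕ ⋯ ⊕ 𝒪(mₖ)` of `𝒪(m₁) ⊕ ⋯ ⊕ 𝒪(mᵣ)`. -/
def firstSummands {r : ℕ} (m : Fin r → ℤ) {k : ℕ} (hk : k ≤ r) :
    Subbundle (splitBundle m) k where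
  fib0 _ := LinearMap.range (firstCoords r k).toLin'
  fib1 _ := LinearMap.range (firstCoords r k).toLin'
  holo0 := isHolFamily_range_firstCoords hk
  holo1 := isHolFamily_range_firstCoords hk
  glue z hz := by
    ext v
    rw [Submodule.mem_map, mem_range_firstCoords hk]
    constructor
    · rintro ⟨u, hu, rfl⟩ a ha
      rw [mem_range_firstCoords hk] at hu
      simp [splitBundle, Matrix.mulVec_diagonal, hu a ha]
    · intro hv
      refine ⟨fun a => z ^ m a * v a, ?_, ?_⟩
      · rw [mem_range_firstCoords hk]
        intro a ha
        simp [hv a ha]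
      · ext a
        simp [splitBundle, Matrix.mulVec_diagonal, zpow_ne_zero _ hz]

theorem firstSummands_hasDegree {r : ℕ} (m : Fin r → ℤ) {k : ℕ} (hk : k ≤ r) :
    (firstSummands m hk).HasDegree (∑ b : Fin k, (m (Fin.castLE hk b) : ℝ)) := by
  refine ⟨splitBundle fun b => m (Fin.castLE hk b),
    ⟨(fun _ => firstCoords r k, fun _ => firstCoords r k), fun _ _ => differentiable_const _,
      fun _ _ => differentiable_const _, fun z _ => ?_⟩, fun _ => rfl, fun _ => rfl,
    degree_splitBundle _⟩
  ext a b
  simp only [splitBundle, Matrix.mul_diagonal, Matrix.diagonal_mul]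
  by_cases h : a.val = b.val
  · have : a = Fin.castLE hk b := Fin.ext h
    simp [this, mul_comm]
  · simp [firstCoords, h]

/-- The block of `φ` leading out of the first `k` summands consists of sections of line bundles of
negative degree. -/
theorem firstSummands_isInvariant {r : ℕ} {m : Fin r → ℤ} {k : ℕ} (hk : k ≤ r)
    (hgap : ∀ a b : Fin r, k ≤ a.val → b.val < k → m a - m b + 2 < 0)
    (φ : HiggsField (splitBundle m)) : (firstSummands m hk).IsInvariant φ := by
  refine ⟨fun z v hv => ?_, fun w v hv => ?_⟩
  all_goals
    simp only [firstSummands, mem_range_firstCoords hk] at hv ⊢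
    intro a ha
    rw [Matrix.mulVec, dotProduct]
    refine Finset.sum_eq_zero fun b _ => ?_
    rcases lt_or_ge b.val k with hb | hb
  · rw [higgs_apply_eq_zero φ (hgap a b ha hb), zero_mul]
  · rw [hv b hb, mul_zero]
  · rw [higgs_apply_eq_zero' φ (hgap a b ha hb), zero_mul]
  · rw [hv b hb, mul_zero]

/-- The necessity of the gap condition for semistability. -/
theorem le_add_two_of_isSemistable {r : ℕ} {m : Fin r → ℤ} (hm : Antitone m)
    {φ : HiggsField (splitBundle m)} (hφ : IsSemistable φ) (i : ℕ) (hi : i + 1 < r) :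
    m ⟨i, Nat.lt_of_succ_lt hi⟩ ≤ m ⟨i + 1, hi⟩ + 2 := by
  by_contra! hgap
  have hk : i + 1 ≤ r := hi.le
  have hlo : ∀ a : Fin r, i + 1 ≤ a.val → m a ≤ m ⟨i + 1, hi⟩ := fun a ha => hm ha
  have hhi : ∀ b : Fin r, b.val < i + 1 → m ⟨i, Nat.lt_of_succ_lt hi⟩ ≤ m b := fun b hb =>
    hm (Nat.lt_succ_iff.1 hb)
  have h := hφ (i + 1) i.succ_pos hi (firstSummands m hk)
    (firstSummands_isInvariant hk (fun a b ha hb => by linarith [hlo a ha, hhi b hb]) φ) _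
    (firstSummands_hasDegree m hk)
  obtain ⟨l, rfl⟩ : ∃ l, r = (i + 1) + (l + 1) := ⟨r - (i + 1) - 1, by omega⟩
  rw [degree_splitBundle,
    Fin.sum_univ_add fun a : Fin ((i + 1) + (l + 1)) => (m a : ℝ)] at h
  set c : ℝ := ((m ⟨i, Nat.lt_of_succ_lt hi⟩ : ℤ) : ℝ)
  set c' : ℝ := ((m ⟨i + 1, hi⟩ : ℤ) : ℝ)
  -- A gap larger than `2` was needed for invariance; for the slopes a strict inequality suffices.
  have hcc : c' < c := by
    simp only [c, c']
    exact_mod_cast (by omega : m ⟨i + 1, hi⟩ < m ⟨i, Nat.lt_of_succ_lt hi⟩)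
  have h1 : (i + 1 : ℝ) * c ≤ ∑ b : Fin (i + 1), (m (Fin.castAdd (l + 1) b) : ℝ) := by
    have := Finset.card_nsmul_le_sum Finset.univ
      (fun b : Fin (i + 1) => (m (Fin.castAdd (l + 1) b) : ℝ)) c
      (fun b _ => Int.cast_le.2 (hhi (Fin.castAdd (l + 1) b) b.2))
    simpa using this
  have h2 : ∑ b : Fin (l + 1), (m (Fin.natAdd (i + 1) b) : ℝ) ≤ (l + 1 : ℝ) * c' := by
    have := Finset.sum_le_card_nsmul Finset.univ
      (fun b : Fin (l + 1) => (m (Fin.natAdd (i + 1) b) : ℝ)) c'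
      (fun b _ => Int.cast_le.2 (hlo (Fin.natAdd (i + 1) b) (Nat.le_add_right _ _)))
    simpa using this
  change (∑ b : Fin (i + 1), (m (Fin.castAdd (l + 1) b) : ℝ)) / _ ≤ _ at h
  set d := ∑ b : Fin (i + 1), (m (Fin.castAdd (l + 1) b) : ℝ)
  set e := ∑ b : Fin (l + 1), (m (Fin.natAdd (i + 1) b) : ℝ)
  rw [div_le_div_iff₀ (by positivity) (by positivity)] at h
  push_cast at h
  have hi0 : (0 : ℝ) < i + 1 := by positivity
  have hl0 : (0 : ℝ) < l + 1 := by positivity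
  -- With denominators cleared, `h` says `(l + 1) * d ≤ (i + 1) * e`, while `(l + 1) * d ≥ (i + 1) *
  -- (l + 1) * c > (i + 1) * (l + 1) * c' ≥ (i + 1) * e`.
  nlinarith [mul_le_mul_of_nonneg_left h1 hl0.le, mul_le_mul_of_nonneg_left h2 hi0.le,
    mul_lt_mul_of_pos_left hcc (mul_pos hi0 hl0)]

end CoHiggs

theorem theorem6p1 (r : ℕ) (hr : 1 < r) (m : Fin r → ℤ) (hm : Antitone m) :
    ((∃ φ : CoHiggs.HiggsField (CoHiggs.splitBundle m), CoHiggs.IsSemistable φ) ↔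
      ∀ (i : ℕ) (hi : i + 1 < r), m ⟨i, Nat.lt_of_succ_lt hi⟩ ≤ m ⟨i + 1, hi⟩ + 2) ∧
    ((∀ (i : ℕ) (hi : i + 1 < r), m ⟨i, Nat.lt_of_succ_lt hi⟩ ≤ m ⟨i + 1, hi⟩ + 2) →
      ∃ S : Set (CoHiggs.HiggsField (CoHiggs.splitBundle m)),
        CoHiggs.IsZariskiOpen S ∧ S.Nonempty ∧
        ∀ φ ∈ S,
          (∀ k : ℕ, 0 < k → k < r →
            ∀ U : CoHiggs.Subbundle (CoHiggs.splitBundle m) k, ¬ U.IsInvariant φ) ∧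
          CoHiggs.IsStable φ) := by
  have key := CoHiggs.exists_zariskiOpen_forall_not_isInvariant (Nat.zero_lt_of_lt hr) hm
  refine ⟨⟨fun ⟨φ, hφ⟩ => CoHiggs.le_add_two_of_isSemistable hm hφ, fun hgap => ?_⟩,
    fun hgap => ?_⟩
  · obtain ⟨S, -, ⟨φ, hφ⟩, hS⟩ := key hgap
    exact ⟨φ, fun k hk hkr U hU => absurd hU (hS φ hφ k hk hkr U)⟩
  · obtain ⟨S, hS₁, hS₂, hS⟩ := key hgap
    exact ⟨S, hS₁, hS₂, fun φ hφ =>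
      ⟨hS φ hφ, fun k hk hkr U hU => absurd hU (hS φ hφ k hk hkr U)⟩⟩
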